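/- A \emph{linear triple system} on a vertex set $V$ is a set of $3$-element subsets (triples) of $V$, any two distinct ones of which intersect in at most one vertex. For an integer $s\ge 1$, an \emph{$s$-pattern} is a finite properly edge-colored forest that is the union of $s$ edge-disjoint monochromatic matchings $M^1,\dots,M^s$ such that, for every $1\le i\le s$, every edge of $M^i$ has an endpoint that is not covered by any edge of any $M^j$ with $i<j\le s$. An \emph{$s$-configuration} is a triple system obtained from an $s$-pattern by choosing distinct new points $v_1,\dots,v_s$, none of them a vertex of the $s$-pattern, and replacing, for every $i$, each edge $e\in M^i$ by the triple $e\cup\{v_i\}$ (such a system is linear). \textbf{Theorem.} For every real $\delta>0$, every integer $s\ge 1$ and every $s$-configuration $\mathcal H$, there is an $n_0=n_0(\delta,s,\mathcal H)$ such that for all $n\ge n_0$, every linear triple system $\mathcal G$ on $n$ vertices with at least $\delta n^2$ triples contains $\mathcal H$ as a subsystem; that is, there is an injection $f$ from the vertices of $\mathcal H$ to the vertices of $\mathcal G$ such that $f(t)$ is a triple of $\mathcal G$ for every triple $t$ of $\mathcal H$. -/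

import Mathlib

/-- A linear triple system (linear `3`-uniform hypergraph) on the vertex set `V`:
any two distinct triples intersect in at most one vertex. -/
structure LinearTripleSystem (V : Type*) where
  /-- The set of triples. -/
  triples : Finset (Finset V)
  card_eq_three : ∀ t ∈ triples, t.card = 3
  linear : ∀ t ∈ triples, ∀ u ∈ triples, t ≠ u → ((t : Set V) ∩ (u : Set V)).Subsingleton

/-- `IsPattern F M`: the graph `F`, with its edges colored by the classes `M 0, …, M (s - 1)`,
is an `s`-pattern. That is, `F` is a properly edge-colored forest which is the (edge-disjoint)
union of the monochromatic matchings `M i`, and every edge of `M i` has an endpoint that is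
not covered by any `M j` with `i < j`. (For a matching, `verts` is the set of vertices covered by
its edges.) -/
structure IsPattern {W : Type*} {s : ℕ} (F : SimpleGraph W) (M : Fin s → F.Subgraph) : Prop where
  isAcyclic : F.IsAcyclic
  isMatching : ∀ i, (M i).IsMatching
  edge_disjoint : ∀ i j, i ≠ j → Disjoint (M i).edgeSet (M j).edgeSet
  union_eq : ⋃ i, (M i).edgeSet = F.edgeSet
  exists_uncovered : ∀ i, ∀ e ∈ (M i).edgeSet, ∃ v ∈ e, ∀ j, i < j → v ∉ (M j).verts

namespace LinearTripleSystem

/-- `H` is an `s`-configuration: its triples are exactly the sets `e ∪ {a i}` with `e` an edge of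
the `i`-th matching of an `s`-pattern, where the augmenting points `a i` are distinct
from each other and from the vertices of the pattern. The vertices of the pattern are those
covered by its edges, i.e. `F.support`; points of `W` lying in no triple are immaterial. -/
def IsConfiguration {W : Type*} (H : LinearTripleSystem W) (s : ℕ) : Prop :=
  ∃ (F : SimpleGraph W) (M : Fin s → F.Subgraph) (a : Fin s → W),
    IsPattern F M ∧ Function.Injective a ∧ (∀ i, a i ∉ F.support) ∧
    ∀ t : Finset W, t ∈ H.triples ↔
      ∃ i, ∃ e ∈ (M i).edgeSet, (t : Set W) = insert (a i) (e : Set W)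

/-- `G` contains (a copy of) `H` as a subsystem. -/
def Contains {V W : Type*} (G : LinearTripleSystem V) (H : LinearTripleSystem W) : Prop :=
  ∃ f : W ↪ V, ∀ t ∈ H.triples, t.map f ∈ G.triples

end LinearTripleSystem

/-!
A set `S` of points colouring a positive proportion of the triples, in the sense that exactly one
point of the triple lies in `S`, exists by averaging (`exists_card_le_coloredBy`). Reading each such
triple as an edge outside `S` coloured by its point in `S` gives a dense graph, properly coloured
because the system is linear, and it remains to find in it a copy of the pattern whose matchings
have distinct colours; vertices and colours cannot collide, as they lie on different sides of `S`.

The main tool is `exists_dense_coveredBy`: in a dense properly coloured graph there is a colour `c`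
such that the set `D` of vertices covered by the edges of colour `c` still spans a positive
proportion of all pairs as edges. Indeed, join each vertex of either of two copies of the graph to
the colours of its edges, and a vertex in the first copy to its neighbours in the second: the
triangles coming from the edges are edge-disjoint and quadratic in number, so by the triangle
removal lemma there are cubically many triangles, and a triangle with apex `c` is an edge inside
`D`.

The pattern is then embedded by induction on the number of matchings
(`IsOrientedPattern.exists_embedding`). Each edge of the first matching has an end `w` not covered
by the others. Choose the colour `c` as above, embed the remaining matchings in the graph induced on
`D`, and map `w` to the partner, along colour `c`, of the image of the other end of its edge. To
keep this injective the embedding is required to avoid a conflict relation of bounded degree. The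
induction conjugates this relation by the involution exchanging partners of colour `c`, which
multiplies the degree by at most four, and deleting the edges with conflicting ends costs only
linearly many edges. With no matchings left, conflict-free vertices are chosen greedily.
-/

namespace LinearTripleSystem

open Finset

/-! ### Coloured edge sets -/

/-- A properly edge-coloured graph on `V` with colours in `V`, encoded by the finite set `R` of
all `(x, y, c)` such that `xy` is an edge of colour `c`; every edge is listed in both
orientations. -/
structure IsColoredEdgeSet {V : Type*} (R : Finset (V × V × V)) : Prop where
  symm : ∀ ⦃x y c⦄, (x, y, c) ∈ R → (y, x, c) ∈ R
  color_unique : ∀ ⦃x y c c'⦄, (x, y, c) ∈ R → (x, y, c') ∈ R → c = c'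
  nbr_unique : ∀ ⦃x y y' c⦄, (x, y, c) ∈ R → (x, y', c) ∈ R → y = y'

/-- The edges of `R` both of whose endpoints are incident with an edge of colour `c`. -/
noncomputable def coveredBy {V : Type*} (R : Finset (V × V × V)) (c : V) :
    Finset (V × V × V) :=
  open Classical in
  R.filter fun p => (∃ z, (p.1, z, c) ∈ R) ∧ ∃ z, (p.2.1, z, c) ∈ R

lemma mem_coveredBy {V : Type*} {R : Finset (V × V × V)} {c x y d : V} :
    (x, y, d) ∈ coveredBy R c ↔
      (x, y, d) ∈ R ∧ (∃ z, (x, z, c) ∈ R) ∧ ∃ z, (y, z, c) ∈ R := by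
  simp [coveredBy]

lemma IsColoredEdgeSet.coveredBy {V : Type*} {R : Finset (V × V × V)}
    (hR : IsColoredEdgeSet R) (c : V) : IsColoredEdgeSet (coveredBy R c) where
  symm x y d h := by
    rw [mem_coveredBy] at h ⊢
    exact ⟨hR.symm h.1, h.2.2, h.2.1⟩
  color_unique x y d d' h h' := hR.color_unique (mem_coveredBy.1 h).1 (mem_coveredBy.1 h').1
  nbr_unique x y y' d h h' := hR.nbr_unique (mem_coveredBy.1 h).1 (mem_coveredBy.1 h').1

/-! ### A colour covering both ends of many edges -/

open SimpleGraph SimpleGraph.TripartiteFromTriangles in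
/-- The triangles of the tripartite graph spanned by the coloured edges, grouped by their vertex
in the colour class, are the edges counted by `coveredBy`. -/
lemma card_cliqueFinset_le_sum {V : Type*} [Fintype V] [DecidableEq V]
    {R : Finset (V × V × V)} (hR : IsColoredEdgeSet R) :
    #((graph R).cliqueFinset 3) ≤ ∑ c, #(coveredBy R c) := by
  rw [← card_sigma]
  refine (card_le_card (t := (univ.sigma fun c => LinearTripleSystem.coveredBy R c).image
    fun q => toTriangle (q.2.1, q.2.2.1, q.1)) fun t ht => ?_).trans card_image_le
  rw [mem_cliqueFinset_iff, is3Clique_iff] at ht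
  obtain ⟨x, y, z, hxy, hxz, hyz, rfl⟩ := ht
  obtain ⟨a, b, c, habc, hab, hac, hbc⟩ := graph_triple hxy hxz hyz
  obtain ⟨d, hd⟩ := Graph.in₀₁_iff.1 hab
  obtain ⟨b', hb'⟩ := Graph.in₀₂_iff.1 hac
  obtain ⟨a', ha'⟩ := Graph.in₁₂_iff.1 hbc
  refine mem_image.2 ⟨⟨c, a, b, d⟩, ?_, habc⟩
  simp only [mem_sigma, mem_univ, true_and]
  exact mem_coveredBy.2 ⟨hd, ⟨b', hb'⟩, ⟨a', hR.symm ha'⟩⟩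

open SimpleGraph SimpleGraph.TripartiteFromTriangles in
/-- A dense properly coloured graph has a colour whose edges cover a set spanning a positive
proportion of all pairs. The triangles (end, end, colour) given by the edges are edge-disjoint,
so this is an instance of the triangle removal lemma. -/
lemma exists_dense_coveredBy {η : ℝ} (hη : 0 < η) :
    ∃ ε : ℝ, 0 < ε ∧ ∀ (V : Type*) [Fintype V] [Nonempty V] (R : Finset (V × V × V)),
      IsColoredEdgeSet R → η * (Fintype.card V : ℝ) ^ 2 ≤ #R →
      ∃ c, ε * (Fintype.card V : ℝ) ^ 2 ≤ #(coveredBy R c) := by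
  classical
  refine ⟨triangleRemovalBound (η / 9) * 27,
    mul_pos (triangleRemovalBound_pos (by positivity)) (by norm_num), fun V _ _ R hR hcard => ?_⟩
  have : ExplicitDisjoint R :=
    ⟨fun a b c a' h h' => hR.nbr_unique (hR.symm h) (hR.symm h'),
      fun a b c b' h h' => hR.nbr_unique h h', fun a b c c' h h' => hR.color_unique h h'⟩
  have hfar : (graph R).FarFromTriangleFree (η / 9) := by
    refine farFromTriangleFree _ ?_
    push_cast
    linarith
  have h1 := hfar.le_card_cliqueFinset.trans (Nat.cast_le.2 (card_cliqueFinset_le_sum hR))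
  simp only [Fintype.card_sum, Nat.cast_add, Nat.cast_sum] at h1
  obtain ⟨c, -, hc⟩ := exists_le_of_sum_le (s := (univ : Finset V))
    (f := fun _ => triangleRemovalBound (η / 9) * 27 * (Fintype.card V : ℝ) ^ 2)
    (g := fun c => (#(LinearTripleSystem.coveredBy R c) : ℝ)) univ_nonempty (by
      rw [sum_const, card_univ, nsmul_eq_mul]
      linarith)
  exact ⟨c, hc⟩

/-! ### Independent sets for a conflict relation of bounded degree -/

/-- `B x` is the set of vertices in conflict with `x`: a reflexive and symmetric relation of
degree at most `Δ`. -/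
structure IsConflict {V : Type*} (B : V → Finset V) (Δ : ℕ) : Prop where
  refl : ∀ x, x ∈ B x
  symm : ∀ ⦃x y⦄, y ∈ B x → x ∈ B y
  card_le : ∀ x, #(B x) ≤ Δ

/-- Pairwise conflict-free vertices can be chosen greedily from a large set. -/
lemma IsConflict.exists_independent {V W : Type*} [Finite W] {B : V → Finset V} {Δ : ℕ}
    (hB : IsConflict B Δ) (A : Finset V) (hA : Nat.card W * Δ < #A) :
    ∃ f : W → V, (∀ w, f w ∈ A) ∧ ∀ w w', w ≠ w' → f w' ∉ B (f w) := by
  classical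
  have := Fintype.ofFinite W
  rw [Nat.card_eq_fintype_card] at hA
  suffices h : ∀ S : Finset W, ∃ f : W → V, (∀ w, f w ∈ A) ∧
      ∀ w ∈ S, ∀ w' ∈ S, w ≠ w' → f w' ∉ B (f w) by
    obtain ⟨f, hf, hf'⟩ := h univ
    exact ⟨f, hf, fun w w' => hf' w (mem_univ _) w' (mem_univ _)⟩
  intro S
  induction S using Finset.induction_on with
  | empty =>
    obtain ⟨a, ha⟩ := card_pos.1 (Nat.zero_lt_of_lt hA)
    exact ⟨fun _ => a, fun _ => ha, by simp⟩
  | insert u S hu ih =>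
    obtain ⟨f, hfA, hf⟩ := ih
    have hlt : #(S.biUnion fun w => B (f w)) < #A :=
      (card_biUnion_le_card_mul _ _ _ fun w _ => hB.card_le _).trans_lt
        ((Nat.mul_le_mul_right _ (card_le_univ S)).trans_lt hA)
    obtain ⟨a, haA, ha⟩ := exists_mem_notMem_of_card_lt_card hlt
    simp only [mem_biUnion, not_exists, not_and] at ha
    have hne : ∀ w ∈ S, w ≠ u := fun w hw h => hu (h ▸ hw)
    refine ⟨Function.update f u a, fun w => ?_, fun w hw w' hw' hww => ?_⟩
    · by_cases h : w = u
      · subst h; simpa using haA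
      · simpa [h] using hfA w
    · rw [mem_insert] at hw hw'
      rcases hw with rfl | hw <;> rcases hw' with rfl | hw'
      · exact absurd rfl hww
      · simpa [hne _ hw'] using fun h => ha _ hw' (hB.symm h)
      · simpa [hne _ hw] using ha _ hw
      · simpa [hne _ hw, hne _ hw'] using hf _ hw _ hw' hww

/-- The vertices conflicting, possibly after applying `φ` on either side, with `x`. -/
noncomputable def conflictWith {V : Type*} (B : V → Finset V) (φ : V → V) (x : V) : Finset V :=
  open Classical in
  (B x ∪ B (φ x)) ∪ (B x ∪ B (φ x)).image φ

lemma mem_conflictWith {V : Type*} {B : V → Finset V} {φ : V → V}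
    (hφ : Function.Involutive φ) {x y : V} :
    y ∈ conflictWith B φ x ↔ (y ∈ B x ∨ y ∈ B (φ x)) ∨ φ y ∈ B x ∨ φ y ∈ B (φ x) := by
  classical
  simp only [conflictWith, mem_union, mem_image]
  refine or_congr Iff.rfl ⟨?_, fun h => ⟨φ y, h, hφ y⟩⟩
  rintro ⟨z, hz, rfl⟩
  rwa [hφ z]

lemma IsConflict.conflictWith {V : Type*} {B : V → Finset V} {Δ : ℕ} (hB : IsConflict B Δ)
    {φ : V → V} (hφ : Function.Involutive φ) : IsConflict (conflictWith B φ) (4 * Δ) where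
  refl x := (mem_conflictWith hφ).2 (.inl (.inl (hB.refl x)))
  symm x y h := by
    rw [mem_conflictWith hφ] at h ⊢
    rcases h with (h | h) | h | h <;> have := hB.symm h <;> tauto
  card_le x := by
    classical
    have h1 : #(B x ∪ B (φ x)) ≤ 2 * Δ :=
      (card_union_le _ _).trans (by have := hB.card_le x; have := hB.card_le (φ x); omega)
    refine (card_union_le _ _).trans ?_
    have := card_image_le (s := B x ∪ B (φ x)) (f := φ)
    omega

/-- Deleting the edges whose ends are in conflict. -/
noncomputable def conflictFree {V : Type*} (R : Finset (V × V × V)) (B : V → Finset V) :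
    Finset (V × V × V) :=
  open Classical in R.filter fun p => p.2.1 ∉ B p.1

lemma mem_conflictFree {V : Type*} {R : Finset (V × V × V)} {B : V → Finset V} {x y c : V} :
    (x, y, c) ∈ conflictFree R B ↔ (x, y, c) ∈ R ∧ y ∉ B x := by
  simp [conflictFree]

lemma IsColoredEdgeSet.conflictFree {V : Type*} {R : Finset (V × V × V)}
    (hR : IsColoredEdgeSet R) {B : V → Finset V} {Δ : ℕ} (hB : IsConflict B Δ) :
    IsColoredEdgeSet (conflictFree R B) where
  symm x y d h := by
    rw [mem_conflictFree] at h ⊢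
    exact ⟨hR.symm h.1, fun h' => h.2 (hB.symm h')⟩
  color_unique x y d d' h h' :=
    hR.color_unique (mem_conflictFree.1 h).1 (mem_conflictFree.1 h').1
  nbr_unique x y y' d h h' := hR.nbr_unique (mem_conflictFree.1 h).1 (mem_conflictFree.1 h').1

lemma IsColoredEdgeSet.card_le_card_conflictFree {V : Type*} [Fintype V]
    {R : Finset (V × V × V)} (hR : IsColoredEdgeSet R) {B : V → Finset V} {Δ : ℕ}
    (hB : IsConflict B Δ) : #R ≤ #(LinearTripleSystem.conflictFree R B) + Fintype.card V * Δ := by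
  classical
  rw [LinearTripleSystem.conflictFree,
    ← card_filter_add_card_filter_not (s := R) (fun p => p.2.1 ∉ B p.1)]
  refine Nat.add_le_add_left ?_ _
  calc _ ≤ #(univ.sigma B) := by
        refine card_le_card_of_injOn (fun p => ⟨p.1, p.2.1⟩) (fun p hp => ?_) ?_
        · simpa using (mem_filter.1 hp).2
        · rintro ⟨x, y, c⟩ hp ⟨x', y', c'⟩ hp' h
          simp only [Sigma.mk.injEq, heq_eq_eq] at h
          obtain ⟨rfl, rfl⟩ := h
          rw [hR.color_unique (mem_filter.1 hp).1 (mem_filter.1 hp').1]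
    _ ≤ _ := by
        rw [card_sigma, ← card_univ, ← smul_eq_mul]
        exact sum_le_card_nsmul _ _ _ fun x _ => hB.card_le x

/-! ### Embedding oriented patterns -/

/-- The combinatorial content of an `s`-pattern: `M i u w` says that `uw` is an edge of the
`i`-th matching, oriented so that `w` is an endpoint not covered by the later matchings. -/
structure IsOrientedPattern {W : Type*} {s : ℕ} (M : Fin s → W → W → Prop) : Prop where
  tail_unique : ∀ ⦃i u u' w⦄, M i u w → M i u' w → u = u'
  head_unique : ∀ ⦃i u w w'⦄, M i u w → M i u w' → w = w'
  not_head : ∀ ⦃i u w t⦄, M i u w → ¬ M i t u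
  uncovered : ∀ ⦃i j u w t⦄, M i u w → i < j → ¬ M j w t ∧ ¬ M j t w

lemma IsOrientedPattern.tail {W : Type*} {s : ℕ} {M : Fin (s + 1) → W → W → Prop}
    (hM : IsOrientedPattern M) : IsOrientedPattern fun i => M i.succ where
  tail_unique _ _ _ _ h h' := hM.tail_unique h h'
  head_unique _ _ _ _ h h' := hM.head_unique h h'
  not_head _ _ _ _ h := hM.not_head h
  uncovered _ _ _ _ _ h hij := hM.uncovered h (Fin.succ_lt_succ_iff.2 hij)

/-- Passing from `x` to its neighbour along an edge of colour `c` (and fixing `x` if there is no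
such edge) is an involution. -/
lemma IsColoredEdgeSet.exists_involutive {V : Type*} {R : Finset (V × V × V)}
    (hR : IsColoredEdgeSet R) (c : V) :
    ∃ φ : V → V, Function.Involutive φ ∧ ∀ x, (∃ z, (x, z, c) ∈ R) → (x, φ x, c) ∈ R := by
  classical
  let φ : V → V := fun x => if h : ∃ z, (x, z, c) ∈ R then h.choose else x
  have hφ : ∀ x, (∃ z, (x, z, c) ∈ R) → (x, φ x, c) ∈ R := fun x h => by
    simpa only [φ, dif_pos h] using h.choose_spec
  refine ⟨φ, fun x => ?_, hφ⟩
  by_cases h : ∃ z, (x, z, c) ∈ R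
  · have h1 := hR.symm (hφ x h)
    exact hR.nbr_unique (hφ _ ⟨x, h1⟩) h1
  · have h1 : φ x = x := dif_neg h
    rw [h1, h1]

/-- An oriented pattern embeds into every dense properly coloured graph, with distinct colours
for distinct matchings and with an image free of conflicts. In the induction the first matching is
embedded last: the later ones are embedded among the vertices covered by a fixed colour, and each
head of the first matching is then placed at the other end of the edge of that colour at the
image of its tail. Strengthening the conflict relation keeps these new vertices apart. -/
theorem IsOrientedPattern.exists_embedding.{u, v} {W : Type u} [Finite W] {s : ℕ} :
    ∀ {M : Fin s → W → W → Prop}, IsOrientedPattern M → ∀ (Δ : ℕ) {δ : ℝ}, 0 < δ →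
    ∃ n₀ : ℕ, ∀ (V : Type v) [Fintype V], n₀ ≤ Fintype.card V →
      ∀ (R : Finset (V × V × V)) (B : V → Finset V), IsColoredEdgeSet R → IsConflict B Δ →
      δ * (Fintype.card V : ℝ) ^ 2 ≤ #R →
      ∃ (f : W → V) (c : Fin s → V), Function.Injective c ∧
        (∀ i u w, M i u w → (f u, f w, c i) ∈ R) ∧
        (∀ w w', w ≠ w' → f w' ∉ B (f w)) ∧
        (∀ w, ∃ y d, (f w, y, d) ∈ R) ∧ ∀ i, ∃ x y, (x, y, c i) ∈ R ∧ y ∉ B x := by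
  induction s with
  | zero =>
    intro M _ Δ δ hδ
    obtain ⟨m, hm⟩ := exists_nat_gt ((Nat.card W * Δ : ℕ) / δ : ℝ)
    refine ⟨m + 1, fun V _ hV R B hR hB hcard => ?_⟩
    classical
    have hle : #R ≤ #(univ.filter fun x => ∃ y d, (x, y, d) ∈ R) * Fintype.card V := by
      rw [← card_univ, ← card_product]
      refine card_le_card_of_injOn (fun p => (p.1, p.2.1)) (fun p hp => ?_) ?_
      · simpa using ⟨p.2.1, p.2.2, hp⟩
      · rintro ⟨x, y, d⟩ hp ⟨x', y', d'⟩ hp' h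
        simp only [Prod.mk.injEq] at h
        obtain ⟨rfl, rfl⟩ := h
        rw [hR.color_unique hp hp']
    obtain ⟨f, hf, hf'⟩ := hB.exists_independent (W := W)
      (univ.filter fun x => ∃ y d, (x, y, d) ∈ R) (by
        have hn : (m : ℝ) + 1 ≤ Fintype.card V := mod_cast hV
        have hle' : (#R : ℝ) ≤ #(univ.filter fun x => ∃ y d, (x, y, d) ∈ R) *
          (Fintype.card V : ℝ) := mod_cast hle
        have hn0 : (0 : ℝ) < Fintype.card V := by
          have : (0 : ℝ) ≤ m := m.cast_nonneg
          linarith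
        have h1 : δ * (Fintype.card V : ℝ) ≤ #(univ.filter fun x => ∃ y d, (x, y, d) ∈ R) := by
          refine le_of_mul_le_mul_right ?_ hn0
          linarith
        rw [div_lt_iff₀ hδ] at hm
        have : ((Nat.card W * Δ : ℕ) : ℝ) < #(univ.filter fun x => ∃ y d, (x, y, d) ∈ R) := by
          nlinarith
        exact mod_cast this)
    exact ⟨f, Fin.elim0, fun i => i.elim0, fun i => i.elim0, hf',
      fun w => (mem_filter.1 (hf w)).2, fun i => i.elim0⟩
  | succ s ih =>
    intro M hM Δ δ hδ
    obtain ⟨ε, hε, hdense⟩ := exists_dense_coveredBy.{v} (half_pos hδ)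
    obtain ⟨n₁, hn₁⟩ := ih hM.tail (4 * Δ) hε
    obtain ⟨m, hm⟩ := exists_nat_gt (2 * Δ / δ : ℝ)
    refine ⟨max n₁ (m + 1), fun V _ hV R B hR hB hcard => ?_⟩
    rw [max_le_iff] at hV
    have hn : (m : ℝ) + 1 ≤ Fintype.card V := mod_cast hV.2
    have : Nonempty V := Fintype.card_pos_iff.1 (by omega)
    set R₀ := conflictFree R B
    have hC₀ : IsColoredEdgeSet R₀ := hR.conflictFree hB
    have hcard₀ : δ / 2 * (Fintype.card V : ℝ) ^ 2 ≤ #R₀ := by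
      have h1 : (#R : ℝ) ≤ #R₀ + Fintype.card V * Δ :=
        mod_cast hR.card_le_card_conflictFree hB
      rw [div_lt_iff₀ hδ] at hm
      have h2 : 0 ≤ (Fintype.card V : ℝ) := Nat.cast_nonneg _
      have h3 : 2 * (Δ : ℝ) ≤ Fintype.card V * δ := by nlinarith
      nlinarith [mul_le_mul_of_nonneg_left h3 h2]
    obtain ⟨c₀, hc₀⟩ := hdense V R₀ hC₀ hcard₀
    obtain ⟨φ, hφ, hφR⟩ := hC₀.exists_involutive c₀
    have hB' := hB.conflictWith hφ
    obtain ⟨f, c, hc, hfM, hfB, hfR, hcR⟩ := hn₁ V hV.1 (coveredBy R₀ c₀) (conflictWith B φ)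
      (hC₀.coveredBy c₀) hB' hc₀
    have hmem : ∀ {x y d}, (x, y, d) ∈ coveredBy R₀ c₀ → (x, y, d) ∈ R ∧ y ∉ B x := fun h =>
      mem_conflictFree.1 (mem_coveredBy.1 h).1
    -- Every `f w` is covered by the colour `c₀`.
    have hfφ : ∀ w, (f w, φ (f w), c₀) ∈ R₀ := fun w => by
      obtain ⟨y, d, h⟩ := hfR w
      exact hφR _ (mem_coveredBy.1 h).2.1
    have hfφ' : ∀ w, (f w, φ (f w), c₀) ∈ R ∧ φ (f w) ∉ B (f w) := fun w =>
      mem_conflictFree.1 (hfφ w)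
    classical
    let g : W → V := fun w => if h : ∃ u, M 0 u w then φ (f h.choose) else f w
    have hg_head : ∀ {u w}, M 0 u w → g w = φ (f u) := fun {u w} h => by
      have h' : ∃ u, M 0 u w := ⟨u, h⟩
      rw [show g w = φ (f h'.choose) from dif_pos h', hM.tail_unique h'.choose_spec h]
    have hg_other : ∀ {w}, (¬ ∃ u, M 0 u w) → g w = f w := fun h => dif_neg h
    have hg_tail : ∀ {u w}, M 0 u w → g u = f u := fun h =>
      hg_other fun ⟨_, ht⟩ => hM.not_head h ht
    -- Conflicts between vertices of the new embedding are ruled out by those of the old one.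
    have hconf : ∀ {p q}, p ≠ q → ∀ x ∈ ({f p, φ (f p)} : Set V),
        ∀ y ∈ ({f q, φ (f q)} : Set V), y ∉ B x := by
      intro p q hpq x hx y hy h
      have h' := hfB p q hpq
      rw [mem_conflictWith hφ] at h'
      rcases hx with rfl | rfl <;> rcases hy with rfl | rfl <;> tauto
    refine ⟨g, Fin.cons c₀ c, ?_, ?_, ?_, ?_, ?_⟩
    · refine Fin.cons_injective_iff.2 ⟨?_, hc⟩
      rintro ⟨i, rfl⟩
      obtain ⟨x, y, hxy, hconfl⟩ := hcR i
      -- An edge of colour `c₀` has the form `x (φ x)`, and its ends are in conflict for the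
      -- enlarged relation.
      have h1 := (mem_coveredBy.1 hxy).1
      have h2 : φ x = y := hC₀.nbr_unique (hφR x ⟨y, h1⟩) h1
      refine hconfl ((mem_conflictWith hφ).2 (.inr (.inl ?_)))
      rw [← h2, hφ x]
      exact hB.refl x
    · intro i u w h
      cases i using Fin.cases with
      | zero =>
        rw [hg_head h, hg_tail h]
        exact (hfφ' u).1
      | succ i =>
        rw [hg_other fun ⟨_, ht⟩ => (hM.uncovered ht i.succ_pos).1 h,
          hg_other fun ⟨_, ht⟩ => (hM.uncovered ht i.succ_pos).2 h]
        exact (hmem (hfM i u w h)).1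
    · -- Each new vertex is `f p` or `φ (f p)` for some `p`. If two of them have the same `p`,
      -- they are joined by an edge of `R₀`.
      intro w w' hww
      by_cases h : ∃ u, M 0 u w <;> by_cases h' : ∃ u, M 0 u w'
      · obtain ⟨u, hu⟩ := h
        obtain ⟨u', hu'⟩ := h'
        rw [hg_head hu, hg_head hu']
        have : u ≠ u' := by
          rintro rfl
          exact hww (hM.head_unique hu hu')
        exact hconf this _ (by simp) _ (by simp)
      · obtain ⟨u, hu⟩ := h
        rw [hg_head hu, hg_other h']
        by_cases huw : u = w'
        · subst huw
          exact fun h => (hfφ' u).2 (hB.symm h)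
        · exact hconf huw _ (by simp) _ (by simp)
      · obtain ⟨u', hu'⟩ := h'
        rw [hg_head hu', hg_other h]
        by_cases huw : w = u'
        · subst huw
          exact (hfφ' w).2
        · exact hconf huw _ (by simp) _ (by simp)
      · rw [hg_other h, hg_other h']
        exact hconf hww _ (by simp) _ (by simp)
    · intro w
      by_cases h : ∃ u, M 0 u w
      · obtain ⟨u, hu⟩ := h
        rw [hg_head hu]
        exact ⟨_, _, hR.symm (hfφ' u).1⟩
      · rw [hg_other h]
        exact ⟨_, _, (hfφ' w).1⟩
    · intro i
      cases i using Fin.cases with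
      | zero =>
        have hpos : (0 : ℝ) < #(coveredBy R₀ c₀) := lt_of_lt_of_le (by
          have : (0 : ℝ) < Fintype.card V := mod_cast Fintype.card_pos
          positivity) hc₀
        obtain ⟨⟨x, y, d⟩, h⟩ := card_pos.1 (Nat.cast_pos.1 hpos)
        obtain ⟨z, hz⟩ := (mem_coveredBy.1 h).2.1
        exact ⟨x, z, mem_conflictFree.1 hz⟩
      | succ i =>
        obtain ⟨x, y, h, -⟩ := hcR i
        exact ⟨x, y, hmem h⟩

/-! ### From triple systems to coloured graphs and back -/

open Classical in
/-- The edges coloured by a set `S` of points of a triple system: the pairs outside `S` that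
form a triple with a point of `S`, coloured by this point. -/
noncomputable def coloredBy {V : Type*} [Fintype V] (G : LinearTripleSystem V) (S : Finset V) :
    Finset (V × V × V) :=
  univ.filter fun p => {p.1, p.2.1, p.2.2} ∈ G.triples ∧ p.1 ∉ S ∧ p.2.1 ∉ S ∧ p.2.2 ∈ S

open Classical in
lemma mem_coloredBy {V : Type*} [Fintype V] {G : LinearTripleSystem V} {S : Finset V}
    {x y c : V} :
    (x, y, c) ∈ G.coloredBy S ↔ {x, y, c} ∈ G.triples ∧ x ∉ S ∧ y ∉ S ∧ c ∈ S := by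
  simp [coloredBy]

open Classical in
lemma ne_of_mem_triples {V : Type*} (G : LinearTripleSystem V) {x y c : V}
    (h : {x, y, c} ∈ G.triples) : x ≠ y ∧ x ≠ c ∧ y ≠ c := by
  have h3 := G.card_eq_three _ h
  refine ⟨?_, ?_, ?_⟩ <;> rintro rfl
  · have := card_le_two (a := x) (b := c)
    simp_all
  · have := card_le_two (a := y) (b := x)
    simp_all
  · have := card_le_two (a := x) (b := y)
    simp_all

open Classical in
/-- Two points lie in at most one common triple. -/
lemma eq_of_mem_triples {V : Type*} (G : LinearTripleSystem V) {x y c c' : V}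
    (h : {x, y, c} ∈ G.triples) (h' : {x, y, c'} ∈ G.triples) : c = c' := by
  obtain ⟨hxy, hxc, hyc⟩ := G.ne_of_mem_triples h
  by_contra hne
  refine hxy (G.linear _ h _ h' (fun heq => ?_) (by simp) (by simp))
  have hmem : c ∈ ({x, y, c'} : Finset V) := heq ▸ by simp
  simp only [mem_insert, mem_singleton] at hmem
  rcases hmem with rfl | rfl | rfl <;> contradiction

lemma isColoredEdgeSet_coloredBy {V : Type*} [Fintype V] (G : LinearTripleSystem V)
    (S : Finset V) : IsColoredEdgeSet (G.coloredBy S) where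
  symm x y c h := by
    classical
    rw [mem_coloredBy] at h ⊢
    refine ⟨?_, h.2.2.1, h.2.1, h.2.2.2⟩
    rw [insert_comm]
    exact h.1
  color_unique x y c c' h h' := by
    classical
    exact G.eq_of_mem_triples (mem_coloredBy.1 h).1 (mem_coloredBy.1 h').1
  nbr_unique x y y' c h h' := by
    classical
    have h1 := (mem_coloredBy.1 h).1
    have h2 := (mem_coloredBy.1 h').1
    rw [pair_comm y c] at h1
    rw [pair_comm y' c] at h2
    exact G.eq_of_mem_triples h1 h2

/-- Three distinct points are split as prescribed by one eighth of all sets. -/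
lemma card_filter_split {V : Type*} [Fintype V] [DecidableEq V] {x y c : V}
    (h : x ≠ y ∧ x ≠ c ∧ y ≠ c) :
    2 ^ Fintype.card V ≤ 8 * #{S : Finset V | x ∉ S ∧ y ∉ S ∧ c ∈ S} := by
  have h3 : #({x, y, c} : Finset V) = 3 := Finset.card_eq_three.2 ⟨x, y, c, h.1, h.2.1, h.2.2, rfl⟩
  have h1 : #(({x, y, c} : Finset V)ᶜ.powerset.image (insert c)) ≤
      #{S : Finset V | x ∉ S ∧ y ∉ S ∧ c ∈ S} := by
    refine card_le_card fun S hS => ?_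
    obtain ⟨T, hT, rfl⟩ := mem_image.1 hS
    rw [mem_powerset] at hT
    have hx : x ∉ T := fun hx => by simpa using hT hx
    have hy : y ∉ T := fun hy => by simpa using hT hy
    simp [h, hx, hy]
  rw [card_image_of_injOn, card_powerset, card_compl, h3] at h1
  · have h4 : 3 ≤ Fintype.card V := h3 ▸ card_le_univ _
    calc 2 ^ Fintype.card V = 8 * 2 ^ (Fintype.card V - 3) := by
          rw [show (8 : ℕ) = 2 ^ 3 by norm_num, ← pow_add]
          congr 1
          omega
      _ ≤ _ := Nat.mul_le_mul_left _ h1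
  · intro T hT T' hT' hTT
    have hc : c ∉ T := fun hc => by simpa using (mem_powerset.1 hT) hc
    have hc' : c ∉ T' := fun hc' => by simpa using (mem_powerset.1 hT') hc'
    rw [← erase_insert hc, ← erase_insert hc']
    exact congrArg (fun A => A.erase c) hTT

/-- Averaging over all sets: some set of points colours at least one eighth as many edges as there
are triples. -/
lemma exists_card_le_coloredBy {V : Type*} [Fintype V] (G : LinearTripleSystem V) :
    ∃ S : Finset V, #G.triples ≤ 8 * #(G.coloredBy S) := by
  classical
  let O : Finset (V × V × V) := univ.filter fun p => {p.1, p.2.1, p.2.2} ∈ G.triples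
  have hO : #G.triples ≤ #O := by
    refine (card_le_card (t := O.image fun p => {p.1, p.2.1, p.2.2}) fun t ht => ?_).trans
      card_image_le
    obtain ⟨x, y, z, -, -, -, rfl⟩ := Finset.card_eq_three.1 (G.card_eq_three t ht)
    exact mem_image.2 ⟨(x, y, z), by simpa [O] using ht, rfl⟩
  obtain ⟨S, -, hS⟩ := exists_le_of_sum_le (s := (univ : Finset (Finset V)))
    (f := fun _ => #G.triples) (g := fun S => 8 * #(G.coloredBy S)) univ_nonempty (by
      calc ∑ _S : Finset V, #G.triples = 2 ^ Fintype.card V * #G.triples := by simp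
        _ ≤ 2 ^ Fintype.card V * #O := Nat.mul_le_mul_left _ hO
        _ = ∑ _p ∈ O, 2 ^ Fintype.card V := by simp [mul_comm]
        _ ≤ ∑ p ∈ O, 8 * #{S : Finset V | p.1 ∉ S ∧ p.2.1 ∉ S ∧ p.2.2 ∈ S} :=
          sum_le_sum fun p hp => card_filter_split (G.ne_of_mem_triples (mem_filter.1 hp).2)
        _ = 8 * ∑ S : Finset V, #{p ∈ O | p.1 ∉ S ∧ p.2.1 ∉ S ∧ p.2.2 ∈ S} := by
          rw [← mul_sum]
          congr 1
          exact sum_card_bipartiteAbove_eq_sum_card_bipartiteBelow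
            (s := O) (t := (univ : Finset (Finset V))) fun p S => p.1 ∉ S ∧ p.2.1 ∉ S ∧ p.2.2 ∈ S
        _ = ∑ S : Finset V, 8 * #(G.coloredBy S) := by
          rw [mul_sum]
          simp only [O, filter_filter, coloredBy])
  exact ⟨S, hS⟩

end LinearTripleSystem

/-! ### Orienting a pattern -/

/-- Each edge of a pattern can be oriented so that its head is not covered by the later
matchings. -/
lemma IsPattern.exists_isOrientedPattern {W : Type*} [Finite W] {s : ℕ} {F : SimpleGraph W}
    {M : Fin s → F.Subgraph} (h : IsPattern F M) :
    ∃ N : Fin s → W → W → Prop, LinearTripleSystem.IsOrientedPattern N ∧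
      ∀ i u w, (M i).Adj u w → N i u w ∨ N i w u := by
  have := Fintype.ofFinite W
  let e := Fintype.equivFin W
  -- If neither end is covered later, an auxiliary linear order on `W` decides.
  let N : Fin s → W → W → Prop := fun i u w =>
    (M i).Adj u w ∧ (∀ j, i < j → w ∉ (M j).verts) ∧
      ((∃ j, i < j ∧ u ∈ (M j).verts) ∨ e u < e w)
  refine ⟨N, ⟨?_, ?_, ?_, ?_⟩, ?_⟩
  · intro i u u' w h1 h2
    exact (h.isMatching i).eq_of_adj_right h1.1 h2.1
  · intro i u w w' h1 h2
    exact (h.isMatching i).eq_of_adj_left h1.1 h2.1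
  · rintro i u w t ⟨h1, h2, h3⟩ ⟨k1, k2, k3⟩
    obtain rfl : t = w := (h.isMatching i).eq_of_adj_left k1.symm h1
    rcases h3 with ⟨j, hij, hj⟩ | h3
    · exact k2 j hij hj
    rcases k3 with ⟨j, hij, hj⟩ | k3
    · exact h2 j hij hj
    exact lt_asymm h3 k3
  · intro i j u w t h1 hij
    exact ⟨fun h2 => h1.2.1 j hij h2.1.fst_mem, fun h2 => h1.2.1 j hij h2.1.snd_mem⟩
  · intro i u w huw
    have key : ∀ {u w}, (M i).Adj u w → (∀ j, i < j → w ∉ (M j).verts) →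
        N i u w ∨ N i w u := by
      intro u w huw hw
      by_cases hu : ∃ j, i < j ∧ u ∈ (M j).verts
      · exact .inl ⟨huw, hw, .inl hu⟩
      · rcases lt_or_gt_of_ne (e.injective.ne huw.ne) with hlt | hlt
        · exact .inl ⟨huw, hw, .inr hlt⟩
        · exact .inr ⟨huw.symm, fun j hij hj => hu ⟨j, hij, hj⟩, .inr hlt⟩
    obtain ⟨v, hv, hvj⟩ := h.exists_uncovered i s(u, w) huw
    rcases Sym2.mem_iff.1 hv with rfl | rfl
    · exact (key huw.symm hvj).symm
    · exact key huw hvj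

/-! ### Embedding configurations -/

theorem mainTheorem2 (δ : ℝ) (hδ : 0 < δ) (s : ℕ) (hs : 1 ≤ s)
    (W : Type*) [Finite W] (H : LinearTripleSystem W) (hH : H.IsConfiguration s) :
    ∃ n₀ : ℕ, ∀ n : ℕ, n₀ ≤ n → ∀ (V : Type*) [Fintype V], Fintype.card V = n →
      ∀ G : LinearTripleSystem V, δ * (n : ℝ) ^ 2 ≤ (G.triples.card : ℝ) → G.Contains H := by
  classical
  obtain ⟨F, M, a, hM, ha, haF, hH⟩ := hH
  obtain ⟨N, hN, hMN⟩ := hM.exists_isOrientedPattern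
  obtain ⟨n₀, hn₀⟩ := hN.exists_embedding 1 (δ := δ / 8) (by positivity)
  refine ⟨n₀, fun n hn V _ hV G hG => ?_⟩
  subst hV
  obtain ⟨S, hS⟩ := G.exists_card_le_coloredBy
  have hS' : (G.triples.card : ℝ) ≤ 8 * (G.coloredBy S).card := mod_cast hS
  -- With the equality relation as conflict relation, conflict-free means injective.
  obtain ⟨f, c, hc, hfN, hfB, hfR, hcR⟩ := hn₀ V hn (G.coloredBy S) (fun x => {x})
    (G.isColoredEdgeSet_coloredBy S)
    ⟨fun x => Finset.mem_singleton_self x, fun x y h => by simp_all, fun x => by simp⟩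
    (by linarith)
  have hf : Function.Injective f := fun w w' h => by
    by_contra hne
    exact hfB w w' hne (by simp [h])
  have hfS : ∀ w, f w ∉ S := fun w => by
    obtain ⟨y, d, h⟩ := hfR w
    exact (LinearTripleSystem.mem_coloredBy.1 h).2.1
  have hcS : ∀ i, c i ∈ S := fun i => by
    obtain ⟨x, y, h, -⟩ := hcR i
    exact (LinearTripleSystem.mem_coloredBy.1 h).2.2.2
  let g : W → V := fun w => if h : ∃ i, a i = w then c h.choose else f w
  have hga : ∀ i, g (a i) = c i := fun i => by
    have h' : ∃ j, a j = a i := ⟨i, rfl⟩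
    rw [show g (a i) = c h'.choose from dif_pos h', ha h'.choose_spec]
  have hgf : ∀ {w}, (¬ ∃ i, a i = w) → g w = f w := fun h => dif_neg h
  have hg : Function.Injective g := by
    intro w w' hww
    by_cases h : ∃ i, a i = w <;> by_cases h' : ∃ i, a i = w'
    · obtain ⟨i, rfl⟩ := h
      obtain ⟨j, rfl⟩ := h'
      rw [hga, hga] at hww
      rw [hc hww]
    · obtain ⟨i, rfl⟩ := h
      rw [hga, hgf h'] at hww
      exact absurd (hww ▸ hcS i) (hfS w')
    · obtain ⟨j, rfl⟩ := h'
      rw [hga, hgf h] at hww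
      exact absurd (hww ▸ hcS j) (hfS w)
    · rw [hgf h, hgf h'] at hww
      exact hf hww
  have hgF : ∀ {w}, w ∈ F.support → g w = f w := fun hw =>
    hgf fun ⟨i, hi⟩ => haF i (hi ▸ hw)
  refine ⟨⟨g, hg⟩, fun t ht => ?_⟩
  obtain ⟨i, e, he, hte⟩ := (hH t).1 ht
  induction e using Sym2.ind with | _ u w => ?_
  have huw : (M i).Adj u w := he
  have hgu : g u = f u := hgF ⟨w, huw.adj_sub⟩
  have hgw : g w = f w := hgF ⟨u, huw.adj_sub.symm⟩
  have ht' : t = {u, w, a i} := by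
    ext x
    rw [← Finset.mem_coe, hte]
    simp
    tauto
  have hmap : t.map ⟨g, hg⟩ = {f u, f w, c i} := by
    rw [ht', ← hgu, ← hgw, ← hga i]
    simp [Finset.map_insert]
  have hcol : (f u, f w, c i) ∈ G.coloredBy S := by
    rcases hMN i u w huw with h | h
    · exact hfN i u w h
    · exact (G.isColoredEdgeSet_coloredBy S).symm (hfN i w u h)
  rw [hmap]
  exact (LinearTripleSystem.mem_coloredBy.1 hcol).1
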